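/- Let $\Bbbk$ be an infinite field and $V$ a finite-dimensional $\Bbbk$-vector space. Let $X\subseteq \mathbb{P}V$ and $L\subseteq\mathbb{P}V^*$ be projective varieties, i.e. sets of $\Bbbk$-points that are common zero loci of homogeneous polynomials; $X$ may be reducible. Let $n=\dim X$, where $\dim X$ is the Krull dimension of the homogeneous coordinate ring of $X$ (the polynomial functions modulo those vanishing on the affine cone over $X$) minus one. Assume that $L$ is irreducible and linearly nondegenerate, i.e. not contained in any proper linear subspace of $\mathbb{P}V^*$. Let $p\in X$. Then there is a nonempty Zariski open subset $\Omega$ of $L^{\times(n+2)}\subseteq(\mathbb{P}V^*)^{\times(n+2)}$ such that for every $(\ell_0,\dots,\ell_{n+1})\in\Omega$ the following holds. Put $W=\{v\in V:\ell_0(v)=\dots=\ell_{n+1}(v)=0\}$. The linear projection \[ \boldsymbol{\ell}:\mathbb{P}V\setminus\mathbb{P}W\to\mathbb{P}(V/W),\qquad [v]\mapsto[v \bmod W], \] is defined on all of $X$, i.e. $X\cap\mathbb{P}W=\emptyset$, and the fiber of its restriction $\boldsymbol{\ell}|_X$ over $\boldsymbol{\ell}(p)$ is exactly one point: $(\boldsymbol{\ell}|_X)^{-1}(\boldsymbol{\ell}(p))=\{p\}$.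 -/

import Mathlib

open scoped LinearAlgebra.Projectivization

namespace ProjGeom

variable {k V : Type*} [Field k] [AddCommGroup V] [Module k V] [FiniteDimensional k V]

/-- The coordinates of a vector with respect to a fixed basis of `V`. The notions below do not
depend on the basis, since a linear change of coordinates preserves (multi)homogeneity. -/
noncomputable def coords (v : V) : Fin (Module.finrank k V) → k :=
  (Module.finBasis k V).repr v

/-- Zariski closed subsets of `ℙ k V`, that is, projective varieties (possibly reducible):
common zero loci of families of homogeneous polynomials. -/
def IsZariskiClosed (Z : Set (ℙ k V)) : Prop :=
  ∃ S : Set (MvPolynomial (Fin (Module.finrank k V)) k),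
    (∀ f ∈ S, ∃ d : ℕ, f.IsHomogeneous d) ∧
      Z = {p | ∀ f ∈ S, MvPolynomial.eval (coords (k := k) p.rep) f = 0}

/-- A polynomial in `m` groups of variables is multihomogeneous of multidegree `d` if it is
homogeneous of degree `d i` in the `i`-th group of variables, for every `i`. -/
def IsMultihomogeneous {m N : ℕ} (f : MvPolynomial (Fin m × Fin N) k) (d : Fin m → ℕ) : Prop :=
  MvPolynomial.IsWeightedHomogeneous (fun x : Fin m × Fin N => (Pi.single x.1 1 : Fin m → ℕ)) f d

/-- Zariski closed subsets of the `m`-fold product `ℙ k V × ⋯ × ℙ k V`: common zero loci of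
families of multihomogeneous polynomials. -/
def IsZariskiClosedProd {m : ℕ} (Z : Set (Fin m → ℙ k V)) : Prop :=
  ∃ S : Set (MvPolynomial (Fin m × Fin (Module.finrank k V)) k),
    (∀ f ∈ S, ∃ d : Fin m → ℕ, IsMultihomogeneous f d) ∧
      Z = {p | ∀ f ∈ S,
        MvPolynomial.eval (fun x : Fin m × Fin (Module.finrank k V) =>
          coords (k := k) (p x.1).rep x.2) f = 0}

/-- `Z` is irreducible: nonempty, and not the union of two proper Zariski closed subsets. -/
def IsIrreducibleVariety (Z : Set (ℙ k V)) : Prop :=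
  Z.Nonempty ∧ ∀ A B : Set (ℙ k V), IsZariskiClosed A → IsZariskiClosed B →
    Z ⊆ A ∪ B → Z ⊆ A ∨ Z ⊆ B

/-- `Z` is linearly nondegenerate: it is not contained in any proper linear subspace. -/
def IsLinearlyNondegenerate (Z : Set (ℙ k V)) : Prop :=
  ∀ H : Submodule k V, H ≠ ⊤ → ∃ p ∈ Z, ¬ p.submodule ≤ H

/-- The affine cone over `X`. -/
def affineCone (X : Set (ℙ k V)) : Set V :=
  {v | v = 0 ∨ ∃ h : v ≠ 0, Projectivization.mk k v h ∈ X}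

/-- The homogeneous coordinate ring of `X`: polynomials modulo those vanishing on the affine
cone over `X`. -/
abbrev HomogeneousCoordinateRing (X : Set (ℙ k V)) : Type _ :=
  MvPolynomial (Fin (Module.finrank k V)) k ⧸
    MvPolynomial.vanishingIdeal k (coords (k := k) '' affineCone X)

/-- `X` has dimension `n`: its homogeneous coordinate ring has Krull dimension `n + 1`. -/
def HasDimension (X : Set (ℙ k V)) (n : ℕ) : Prop :=
  ringKrullDim (HomogeneousCoordinateRing X) = ((n + 1 : ℕ) : WithBot ℕ∞)

/-- A property holds for a generic tuple in `L × ⋯ × L` (`m` factors) if it holds for all tuples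
in some nonempty Zariski open subset of `L × ⋯ × L`, the complement of the closed set `Z`. -/
def GenericTuple (L : Set (ℙ k V)) (m : ℕ) (P : (Fin m → ℙ k V) → Prop) : Prop :=
  ∃ Z : Set (Fin m → ℙ k V), IsZariskiClosedProd Z ∧
    (∃ ℓ : Fin m → ℙ k V, (∀ i, ℓ i ∈ L) ∧ ℓ ∉ Z) ∧
    ∀ ℓ : Fin m → ℙ k V, (∀ i, ℓ i ∈ L) → ℓ ∉ Z → P ℓ

end ProjGeom

namespace ProjGeom

variable {k V : Type*} [Field k] [AddCommGroup V] [Module k V]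

/-- The linear subspace of `V` annihilated by all linear forms `ℓ i`; its projectivization is
`⟨ℓ₀, …, ℓₘ₋₁⟩^⊥ ⊆ ℙ k V`. -/
def annihilator {m : ℕ} (ℓ : Fin m → ℙ k (Module.Dual k V)) : Submodule k V :=
  (⨆ i, (ℓ i).submodule).dualCoannihilator

/-- The points of `ℙ k V` outside the projectivization of `W`: the domain of definition of the
linear projection from `W`. -/
def projectionDomain (W : Submodule k V) : Set (ℙ k V) :=
  {p | ¬ p.submodule ≤ W}

theorem mkQ_rep_ne_zero (W : Submodule k V) (p : projectionDomain W) :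
    W.mkQ p.1.rep ≠ 0 := by
  intro h
  apply p.2
  rw [Projectivization.submodule_eq, Submodule.span_singleton_le_iff_mem]
  simpa using h

/-- The linear projection `ℙ V ⇢ ℙ (V / W)`, `[v] ↦ [v mod W]`, on its domain of definition. -/
noncomputable def linearProjection (W : Submodule k V) (p : projectionDomain W) :
    ℙ k (V ⧸ W) :=
  Projectivization.mk k (W.mkQ p.1.rep) (mkQ_rep_ne_zero W p)

end ProjGeom

/-! Let `C` be the set of vectors `v + c • p.rep` with `v` in the affine cone over `X`. If `C ∩ W =
0`, then `X` misses `ℙW`, and a point `q` with the same image as `p` gives a vector `q.rep - c •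
p.rep` of `C ∩ W`, hence `q = p`. It thus suffices that `n + 2` generic members of `L` have no
common zero on `C` except the origin.

The ring of `C` embeds in a polynomial ring in one variable over that of `X`, so its dimension is at
most `n + 2` (`ringKrullDim_quotient_vanishingIdeal_add_smul_le`). As `L` is irreducible and
nondegenerate, it contains a form outside any finite set of primes not containing the irrelevant
ideal; `n + 2` such choices bring the dimension down to at most `0`.

Openness is made explicit: modulo the ideal of `C`, the chosen forms then generate all forms of some
degree `d + 1`. This is a spanning condition, detected by a multihomogeneous determinant, and it
forces every common zero on `C` to be `0`. -/

/-! ### Krull dimension: subalgebras and hypersurface sections -/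

theorem ringKrullDim_le_of_isIntegral {A B : Type*} [CommRing A] [CommRing B] [Algebra A B]
    [Algebra.IsIntegral A B] : ringKrullDim B ≤ ringKrullDim A :=
  Order.krullDim_le_of_strictMono (PrimeSpectrum.comap (algebraMap A B)) fun _ _ h =>
    Ideal.IsIntegral.comap_lt_comap h

theorem ringKrullDim_le_of_isIntegral_of_injective {A B : Type*} [CommRing A] [CommRing B]
    [Algebra A B] [Algebra.IsIntegral A B] (hinj : Function.Injective (algebraMap A B)) :
    ringKrullDim A ≤ ringKrullDim B := by
  refine iSup_le fun l => ?_
  obtain ⟨P, -, hP, hPl⟩ := Ideal.exists_ideal_over_prime_of_isIntegral l.head.asIdeal (⊥ : Ideal B)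
    (by rw [← RingHom.ker_eq_comap_bot, (RingHom.injective_iff_ker_eq_bot _).1 hinj]; exact bot_le)
  have : P.LiesOver l.head.asIdeal := ⟨hPl.symm⟩
  obtain ⟨l', hl', -⟩ := Ideal.exists_ltSeries_of_hasGoingUp l P
  rw [← hl']
  exact Order.LTSeries.length_le_krullDim l'

-- Noether normalization of `A` gives a polynomial ring in `s ≥ dim A` variables inside `B`. Some
-- prime `Q` of `B` contracts to its zero ideal, so it embeds in `B ⧸ Q`; comparing transcendence
-- degrees with a normalization of `B ⧸ Q` bounds `s` by the dimension of `B ⧸ Q`.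
open MvPolynomial in
theorem ringKrullDim_le_of_injective_algHom {k A B : Type*} [Field k] [CommRing A] [CommRing B]
    [Algebra k A] [Algebra k B] [Algebra.FiniteType k A] [Algebra.FiniteType k B]
    (φ : A →ₐ[k] B) (hφ : Function.Injective φ) : ringKrullDim A ≤ ringKrullDim B := by
  cases subsingleton_or_nontrivial A
  · simp [ringKrullDim_eq_bot_of_subsingleton]
  obtain ⟨s, g, hg, hgi⟩ := exists_integral_inj_algHom_of_fg k A
  have hAs : ringKrullDim A ≤ s := by
    let := g.toRingHom.toAlgebra
    have : Algebra.IsIntegral (MvPolynomial (Fin s) k) A := ⟨hgi⟩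
    refine (ringKrullDim_le_of_isIntegral (A := MvPolynomial (Fin s) k)).trans ?_
    rw [MvPolynomial.ringKrullDim_of_isNoetherianRing]
    simp
  have hinj : Function.Injective (φ.comp g) := hφ.comp hg
  obtain ⟨Q, hQ, hQc⟩ := Ideal.exists_comap_eq_of_mem_minimalPrimes_of_injective
    (f := (φ.comp g).toRingHom) hinj ⊥ (by simp [IsDomain.minimalPrimes_eq_singleton_bot])
  have hQi : Function.Injective ((Ideal.Quotient.mkₐ k Q).comp (φ.comp g)) := by
    rw [injective_iff_map_eq_zero]
    intro x hx
    have : x ∈ Ideal.comap (φ.comp g).toRingHom Q :=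
      Ideal.mem_comap.2 (Ideal.Quotient.eq_zero_iff_mem.1 hx)
    rwa [hQc] at this
  obtain ⟨r, g', hg', hgi'⟩ := exists_integral_inj_algHom_of_fg k (B ⧸ Q)
  let := g'.toRingHom.toAlgebra
  have : Algebra.IsIntegral (MvPolynomial (Fin r) k) (B ⧸ Q) := ⟨hgi'⟩
  have : IsScalarTower k (MvPolynomial (Fin r) k) (B ⧸ Q) :=
    IsScalarTower.of_algebraMap_eq fun x => (g'.commutes x).symm
  have : FaithfulSMul (MvPolynomial (Fin r) k) (B ⧸ Q) :=
    (faithfulSMul_iff_algebraMap_injective _ _).2 hg'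
  have hrB := ringKrullDim_le_of_isIntegral_of_injective
    (A := MvPolynomial (Fin r) k) (B := B ⧸ Q) hg'
  rw [MvPolynomial.ringKrullDim_of_isNoetherianRing] at hrB
  have htr := lift_trdeg_le_of_injective _ hQi
  have hcard := ((IsTranscendenceBasis.mvPolynomial (Fin r) k).algebraMap_comp
    (A := B ⧸ Q)).lift_cardinalMk_eq_trdeg
  rw [MvPolynomial.trdeg_of_isDomain] at htr
  have hsr : s ≤ r := by
    simp only [Cardinal.mk_fin, Cardinal.lift_natCast] at htr hcard
    rw [Cardinal.nat_eq_lift_iff] at hcard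
    rw [Cardinal.nat_le_lift_iff, ← hcard] at htr
    exact_mod_cast htr
  calc ringKrullDim A ≤ s := hAs
    _ ≤ r := by exact_mod_cast hsr
    _ ≤ ringKrullDim (B ⧸ Q) := by simpa using hrB
    _ ≤ ringKrullDim B := ringKrullDim_quotient_le Q

/-- A chain of positive length above `I ⊔ (t)` can be prolonged downwards by a minimal prime `P` of
`I`: `P` does not contain `M`, since otherwise both ends of the chain would equal `M`; hence `t ∉ P`
and the inclusion is strict. -/
theorem ringKrullDim_quotient_sup_span_singleton_le {S : Type*} [CommRing S] {I M : Ideal S}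
    (hM : M.IsMaximal) {m : ℕ} (hI : ringKrullDim (S ⧸ I) ≤ (m + 1 : ℕ)) {t : S}
    (ht : ∀ P ∈ I.minimalPrimes, ¬ M ≤ P → t ∉ P) :
    ringKrullDim (S ⧸ (I ⊔ Ideal.span {t})) ≤ m := by
  rw [ringKrullDim_quotient] at hI ⊢
  refine iSup_le fun l => ?_
  rcases Nat.eq_zero_or_pos l.length with h0 | hpos
  · simp [h0]
  have hIQ : I ≤ l.head.1.asIdeal := le_sup_left.trans l.head.2
  have htQ : t ∈ l.head.1.asIdeal :=
    l.head.2 (le_sup_right (a := I) (Ideal.mem_span_singleton_self t))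
  obtain ⟨P, hP, hPQ⟩ := Ideal.exists_minimalPrimes_le hIQ
  have hlt : l.head.1 < l.last.1 := by
    have : NeZero l.length := ⟨hpos.ne'⟩
    exact l.strictMono (Fin.last_pos' (n := l.length))
  have hMP : ¬ M ≤ P := fun h =>
    hlt.not_ge (by
      have h1 := hM.eq_of_le l.head.1.isPrime.ne_top (h.trans hPQ)
      have h2 := hM.eq_of_le l.last.1.isPrime.ne_top ((h.trans hPQ).trans hlt.le)
      exact (h2.symm.trans h1).le)
  have hPlt : (⟨P, hP.1.1⟩ : PrimeSpectrum S) < l.head.1 := by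
    refine lt_of_le_of_ne hPQ fun h => ht P hP hMP ?_
    rw [← h] at htQ
    exact htQ
  have hsub : PrimeSpectrum.zeroLocus ((I ⊔ Ideal.span {t} : Ideal S) : Set S) ⊆
      PrimeSpectrum.zeroLocus (I : Set S) :=
    PrimeSpectrum.zeroLocus_anti_mono_ideal le_sup_left
  let l' : LTSeries (PrimeSpectrum.zeroLocus (I : Set S)) :=
    (l.map (Set.inclusion hsub) fun _ _ h => h).cons ⟨⟨P, hP.1.1⟩, hP.1.2⟩ hPlt
  have hl' := (Order.LTSeries.length_le_krullDim l').trans hI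
  have hlen : l'.length = l.length + 1 := RelSeries.cons_length _ _ _
  rw [hlen] at hl'
  have : l.length + 1 ≤ m + 1 := by exact_mod_cast hl'
  exact_mod_cast Nat.le_of_succ_le_succ this

theorem exists_ringKrullDim_quotient_sup_span_range_le_zero {S : Type*} [CommRing S]
    [IsNoetherianRing S] {M : Ideal S} (hM : M.IsMaximal) {T : Set S}
    (hT : ∀ F : Set (Ideal S), F.Finite → (∀ P ∈ F, ¬ M ≤ P) → ∃ t ∈ T, ∀ P ∈ F, t ∉ P)
    (m : ℕ) (I : Ideal S) (hI : ringKrullDim (S ⧸ I) ≤ m) :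
    ∃ t : Fin m → S, (∀ i, t i ∈ T) ∧
      ringKrullDim (S ⧸ (I ⊔ Ideal.span (Set.range t))) ≤ 0 := by
  induction m generalizing I with
  | zero => exact ⟨Fin.elim0, fun i => i.elim0, by
      rw [Set.range_eq_empty, Ideal.span_empty, sup_bot_eq]; simpa using hI⟩
  | succ m ih =>
    obtain ⟨t₀, ht₀T, ht₀⟩ := hT {P ∈ I.minimalPrimes | ¬ M ≤ P}
      (I.finite_minimalPrimes_of_isNoetherianRing.subset (Set.sep_subset _ _)) fun P hP => hP.2
    obtain ⟨t, htT, ht⟩ := ih (I ⊔ Ideal.span {t₀})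
      (ringKrullDim_quotient_sup_span_singleton_le hM hI fun P hP hMP => ht₀ P ⟨hP, hMP⟩)
    refine ⟨Fin.cons t₀ t, fun i => Fin.cases ht₀T htT i, ?_⟩
    rwa [Fin.range_cons, Set.insert_eq, Ideal.span_union, ← sup_assoc]

/-! ### Graded consequences of a zero-dimensional quotient -/

namespace MvPolynomial

theorem homogeneousComponent_mul_of_isHomogeneous {σ R : Type*} [CommSemiring R]
    {f : MvPolynomial σ R} {m : ℕ} (hf : f.IsHomogeneous m) (g : MvPolynomial σ R) (n : ℕ) :
    homogeneousComponent (m + n) (f * g) = f * homogeneousComponent n g := by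
  conv_lhs => rw [← sum_homogeneousComponent g, Finset.mul_sum, map_sum]
  have h (i : ℕ) : homogeneousComponent (m + n) (f * homogeneousComponent i g) =
      if i = n then f * homogeneousComponent n g else 0 := by
    rw [homogeneousComponent_of_mem (hf.mul (homogeneousComponent_isHomogeneous i g))]
    split_ifs with h1 h2 h2
    · rw [h2]
    · omega
    · omega
    · rfl
  simp_rw [h, Finset.sum_ite_eq']
  split_ifs with hn
  · rfl
  · rw [homogeneousComponent_eq_zero _ _ (by simpa using hn), mul_zero]

/-- The quotient by `J` is Artinian, so the powers of the irrelevant ideal stabilize there, say from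
exponent `d`. A form of degree `d + 1` is then congruent modulo `J` to a polynomial `q` with all
terms of degree at least `d + 2`; taking components of degree `d + 1` removes `q`. -/
theorem exists_forall_isHomogeneous_sub_sum_mem {σ k : Type*} [Finite σ] [Field k]
    {I : Ideal (MvPolynomial σ k)}
    (hI : ∀ f ∈ I, ∀ n, homogeneousComponent n f ∈ I) {m : ℕ} {t : Fin m → MvPolynomial σ k}
    (ht : ∀ i, (t i).IsHomogeneous 1)
    (hdim : ringKrullDim (MvPolynomial σ k ⧸ (I ⊔ Ideal.span (Set.range t))) ≤ 0) :
    ∃ d, ∀ f : MvPolynomial σ k, f.IsHomogeneous (d + 1) →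
      ∃ g : Fin m → MvPolynomial σ k, (∀ i, (g i).IsHomogeneous d) ∧ f - ∑ i, t i * g i ∈ I := by
  set J := I ⊔ Ideal.span (Set.range t)
  have : Ring.KrullDimLE 0 (MvPolynomial σ k ⧸ J) := by
    rw [Ring.KrullDimLE, Order.krullDimLE_iff]
    exact_mod_cast hdim
  have : IsArtinianRing (MvPolynomial σ k ⧸ J) := IsNoetherianRing.isArtinianRing_of_krullDimLE_zero
  obtain ⟨d, hd⟩ := IsArtinian.monotone_stabilizes (R := MvPolynomial σ k ⧸ J)
    (⟨fun n => OrderDual.toDual (((idealOfVars σ k).map (Ideal.Quotient.mk J)) ^ n),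
      fun a b h => Ideal.pow_le_pow_right h⟩ : ℕ →o (Ideal (MvPolynomial σ k ⧸ J))ᵒᵈ)
  refine ⟨d, fun f hf => ?_⟩
  have hfM : f ∈ (idealOfVars σ k) ^ (d + 1) := by
    rw [mem_pow_idealOfVars_iff']
    exact fun x hx => hf.coeff_eq_zero hx.ne
  have hfJ : Ideal.Quotient.mk J f ∈ ((idealOfVars σ k) ^ (d + 2)).map (Ideal.Quotient.mk J) := by
    have h1 := hd (d + 1) (Nat.le_succ d)
    have h2 := hd (d + 2) (by omega)
    have h3 : (idealOfVars σ k).map (Ideal.Quotient.mk J) ^ (d + 1) =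
        (idealOfVars σ k).map (Ideal.Quotient.mk J) ^ (d + 2) := h1.symm.trans h2
    rw [Ideal.map_pow, ← h3, ← Ideal.map_pow]
    exact Ideal.mem_map_of_mem _ hfM
  obtain ⟨q, hq, hqf⟩ := (Ideal.mem_map_iff_of_surjective _ Ideal.Quotient.mk_surjective).1 hfJ
  have hfq : f - q ∈ J := Ideal.Quotient.eq.1 hqf.symm
  obtain ⟨a, ha, b, hb, hab⟩ := Submodule.mem_sup.1 hfq
  obtain ⟨c, hc⟩ := Ideal.mem_span_range_iff_exists_fun.1 hb
  have hq0 : homogeneousComponent (d + 1) q = 0 := by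
    rw [mem_pow_idealOfVars_iff'] at hq
    ext x
    rw [coeff_homogeneousComponent]
    split_ifs with h
    · exact hq x (by omega)
    · simp
  refine ⟨fun i => homogeneousComponent d (c i), fun i => homogeneousComponent_isHomogeneous _ _, ?_⟩
  have := hI a ha (d + 1)
  convert this using 1
  have hab' : a = f - q - ∑ i, t i * c i := by
    rw [← hab, ← hc]; simp [mul_comm]
  rw [hab', map_sub, map_sub, hq0, map_sum, homogeneousComponent_eq_self hf, sub_zero]
  congr 1
  refine Finset.sum_congr rfl fun i _ => ?_
  rw [add_comm d 1, homogeneousComponent_mul_of_isHomogeneous (ht i)]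

end MvPolynomial

/-! ### Linear forms and the choice of points in `L` -/

namespace ProjGeom

section LinearPolynomial

variable {k V : Type*} [Field k] [AddCommGroup V] [Module k V] [FiniteDimensional k V]

/-- A linear form on `V` as a homogeneous polynomial of degree one in the coordinates. -/
noncomputable def linearPolynomial :
    Module.Dual k V →ₗ[k] MvPolynomial (Fin (Module.finrank k V)) k where
  toFun φ := ∑ j, φ (Module.finBasis k V j) • MvPolynomial.X j
  map_add' φ ψ := by simp [add_smul, Finset.sum_add_distrib]
  map_smul' c φ := by simp [mul_smul, Finset.smul_sum]

theorem linearPolynomial_apply (φ : Module.Dual k V) :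
    linearPolynomial φ = ∑ j, φ (Module.finBasis k V j) • MvPolynomial.X j :=
  rfl

theorem isHomogeneous_linearPolynomial (φ : Module.Dual k V) :
    (linearPolynomial φ).IsHomogeneous 1 :=
  MvPolynomial.IsHomogeneous.sum _ _ _ fun j _ => by
    rw [MvPolynomial.smul_eq_C_mul]
    exact MvPolynomial.isHomogeneous_C_mul_X _ _

theorem eval_coords_linearPolynomial (φ : Module.Dual k V) (v : V) :
    MvPolynomial.eval (coords (k := k) v) (linearPolynomial φ) = φ v := by
  conv_rhs => rw [← (Module.finBasis k V).sum_repr v, map_sum]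
  simp [linearPolynomial_apply, coords, MvPolynomial.smul_eval, mul_comm]

theorem linearPolynomial_coord (j : Fin (Module.finrank k V)) :
    linearPolynomial ((Module.finBasis k V).coord j) = MvPolynomial.X j := by
  rw [linearPolynomial_apply, Finset.sum_eq_single j]
  · simp
  · intro i _ hij
    simp [Finsupp.single_eq_of_ne hij.symm]
  · simp

/-- By induction: otherwise `L` would be covered by the zero loci of `φ` and of the product over
`s`, and irreducibility would put it inside one of them. -/
theorem exists_mem_forall_apply_rep_ne_zero {L : Set (ℙ k V)} (hLirr : IsIrreducibleVariety L)
    (s : Finset (Module.Dual k V)) (hs : ∀ φ ∈ s, ∃ p ∈ L, φ p.rep ≠ 0) :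
    ∃ p ∈ L, ∀ φ ∈ s, φ p.rep ≠ 0 := by
  classical
  induction s using Finset.induction_on with
  | empty =>
    obtain ⟨p, hp⟩ := hLirr.1
    exact ⟨p, hp, by simp⟩
  | insert φ s _ ih =>
    obtain ⟨q, hqL, hq⟩ := ih fun ψ hψ => hs ψ (Finset.mem_insert_of_mem hψ)
    obtain ⟨r, hrL, hr⟩ := hs φ (Finset.mem_insert_self φ s)
    by_contra! hcon
    have hclosed (f : MvPolynomial (Fin (Module.finrank k V)) k) (d : ℕ) (hf : f.IsHomogeneous d) :
        IsZariskiClosed {p : ℙ k V | MvPolynomial.eval (coords (k := k) p.rep) f = 0} :=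
      ⟨{f}, by simpa using ⟨d, hf⟩, by simp⟩
    rcases hLirr.2 _ _ (hclosed _ _ (isHomogeneous_linearPolynomial φ))
      (hclosed (∏ ψ ∈ s, linearPolynomial ψ) _
        (MvPolynomial.IsHomogeneous.prod _ _ _ fun ψ _ => isHomogeneous_linearPolynomial ψ))
      (fun p hp => by
        obtain ⟨ψ, hψ, hψp⟩ := hcon p hp
        rcases Finset.mem_insert.1 hψ with rfl | hψs
        · exact Or.inl ((eval_coords_linearPolynomial ψ p.rep).trans hψp)
        · refine Or.inr ?_
          simp only [Set.mem_ofPred_eq, map_prod, eval_coords_linearPolynomial]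
          exact Finset.prod_eq_zero hψs hψp) with h | h
    · exact hr ((eval_coords_linearPolynomial φ r.rep).symm.trans (h hrL))
    · have := h hqL
      simp only [Set.mem_ofPred_eq, map_prod, eval_coords_linearPolynomial] at this
      obtain ⟨ψ, hψ, hψq⟩ := Finset.prod_eq_zero_iff.1 this
      exact hq ψ hψ hψq

theorem exists_mem_forall_rep_notMem {L : Set (ℙ k V)} (hLirr : IsIrreducibleVariety L)
    (hLnd : IsLinearlyNondegenerate L) {s : Set (Submodule k V)} (hs : s.Finite)
    (hproper : ∀ H ∈ s, H ≠ ⊤) : ∃ p ∈ L, ∀ H ∈ s, p.rep ∉ H := by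
  classical
  have hφ (H : Submodule k V) : ∃ φ : Module.Dual k V, H ≠ ⊤ → φ ≠ 0 ∧ H ≤ LinearMap.ker φ := by
    by_cases hH : H = ⊤
    · exact ⟨0, fun h => (h hH).elim⟩
    · obtain ⟨φ, hφ0, hφ⟩ := H.exists_le_ker_of_lt_top (lt_top_iff_ne_top.2 hH)
      exact ⟨φ, fun _ => ⟨hφ0, hφ⟩⟩
  choose φ hφ using hφ
  obtain ⟨p, hp, hpφ⟩ := exists_mem_forall_apply_rep_ne_zero hLirr (hs.toFinset.image φ) (by
    intro ψ hψ
    obtain ⟨H, hH, rfl⟩ := Finset.mem_image.1 hψ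
    obtain ⟨hφ0, -⟩ := hφ H (hproper H (hs.mem_toFinset.1 hH))
    obtain ⟨p, hp, hpk⟩ := hLnd (LinearMap.ker (φ H)) (by rwa [Ne, LinearMap.ker_eq_top])
    refine ⟨p, hp, fun h0 => hpk ?_⟩
    rw [Projectivization.submodule_eq, Submodule.span_singleton_le_iff_mem]
    exact h0)
  refine ⟨p, hp, fun H hH hpH => ?_⟩
  exact hpφ (φ H) (Finset.mem_image_of_mem _ (hs.mem_toFinset.2 hH))
    ((hφ H (hproper H hH)).2 hpH)

end LinearPolynomial

/-! ### Openness of a spanning condition -/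

section Multihomogeneous

variable {k D E : Type*} [Field k] [AddCommGroup D] [Module k D] [FiniteDimensional k D]
  [AddCommGroup E] [Module k E]

/-- The locus where finitely many vectors depending linearly on the entries of a tuple span a
finite-dimensional space is a union of nonvanishing loci of multihomogeneous polynomials. -/
theorem exists_isMultihomogeneous_of_span_eq_top [FiniteDimensional k E] {m : ℕ} {A : Type*} (B : A → D →ₗ[k] E)
    (l₀ : Fin m → D)
    (h : Submodule.span k (Set.range fun x : Fin m × A => B x.2 (l₀ x.1)) = ⊤) :
    ∃ (F : MvPolynomial (Fin m × Fin (Module.finrank k D)) k) (d : Fin m → ℕ),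
      IsMultihomogeneous F d ∧
      MvPolynomial.eval (fun x => coords (k := k) (l₀ x.1) x.2) F ≠ 0 ∧
      ∀ l : Fin m → D, MvPolynomial.eval (fun x => coords (k := k) (l x.1) x.2) F ≠ 0 →
        Submodule.span k (Set.range fun x : Fin m × A => B x.2 (l x.1)) = ⊤ := by
  classical
  -- The spanning vectors at `l₀` contain a basis `b`. The polynomial sought is the determinant,
  -- with respect to `b`, of the vectors with the same indices at a variable tuple.
  obtain ⟨κ, a, -, hspan, hli⟩ :=
    exists_linearIndependent' k (fun x : Fin m × A => B x.2 (l₀ x.1))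
  let b : Module.Basis κ k E := Module.Basis.mk hli (by rw [hspan, h])
  have : Fintype κ := FiniteDimensional.fintypeBasisIndex b
  let N : Matrix κ κ (MvPolynomial (Fin m × Fin (Module.finrank k D)) k) :=
    Matrix.of fun s r => ∑ j,
      MvPolynomial.C (b.repr (B (a r).2 (Module.finBasis k D j)) s) * MvPolynomial.X ((a r).1, j)
  have heval (l : Fin m → D) : MvPolynomial.eval (fun x => coords (k := k) (l x.1) x.2) N.det =
      b.det fun r => B (a r).2 (l (a r).1) := by
    rw [RingHom.map_det, Module.Basis.det_apply]
    congr 1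
    ext s r
    have hl := congrArg (fun v => b.repr (B (a r).2 v) s)
      ((Module.finBasis k D).sum_repr (l (a r).1))
    rw [Module.Basis.toMatrix_apply, ← hl]
    simp [N, coords, mul_comm, -Module.Basis.sum_repr]
  -- Column `r` of `N` is linear in the variables of group `(a r).1` alone, whence the multidegree.
  refine ⟨N.det, ∑ r, Pi.single (a r).1 1, ?_, ?_, ?_⟩
  · rw [Matrix.det_apply]
    refine MvPolynomial.IsWeightedHomogeneous.sum _ _ _ fun τ _ => ?_
    rw [Units.smul_def, zsmul_eq_mul, ← map_intCast (MvPolynomial.C (R := k))]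
    refine MvPolynomial.IsWeightedHomogeneous.C_mul ?_ _
    refine MvPolynomial.IsWeightedHomogeneous.prod _ _ _ fun r _ => ?_
    simp only [N, Matrix.of_apply]
    refine MvPolynomial.IsWeightedHomogeneous.sum _ _ _ fun j _ => ?_
    exact (MvPolynomial.isWeightedHomogeneous_X k _ _).C_mul _
  · rw [heval]
    have : (fun r => B (a r).2 (l₀ (a r).1)) = b := by
      ext r
      simp [b]
    rw [this, b.det_self]
    exact one_ne_zero
  · intro l hl
    rw [heval] at hl
    have := ((Module.Basis.is_basis_iff_det b).2 (isUnit_iff_ne_zero.2 hl)).2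
    rw [eq_top_iff, ← this]
    refine Submodule.span_mono ?_
    rintro _ ⟨r, rfl⟩
    exact ⟨a r, rfl⟩

end Multihomogeneous

end ProjGeom

/-! ### Vanishing ideals of cones and the dimension of a join -/

namespace MvPolynomial

theorem IsHomogeneous.eval_smul {σ R : Type*} [CommSemiring R] {f : MvPolynomial σ R} {n : ℕ}
    (hf : f.IsHomogeneous n) (c : R) (v : σ → R) : eval (c • v) f = c ^ n * eval v f := by
  rw [eval_eq, eval_eq, Finset.mul_sum]
  refine Finset.sum_congr rfl fun d hd => ?_
  have hdeg : n = ∑ i ∈ d.support, d i := hf.degree_eq_sum_deg_support hd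
  simp only [Pi.smul_apply, smul_eq_mul, mul_pow, Finset.prod_mul_distrib]
  rw [Finset.prod_pow_eq_pow_sum, ← hdeg]
  ring

theorem homogeneousComponent_mem_vanishingIdeal {σ k : Type*} [Field k] [Infinite k]
    {C : Set (σ → k)} (hC : ∀ c : k, ∀ v ∈ C, c • v ∈ C) {f : MvPolynomial σ k}
    (hf : f ∈ vanishingIdeal k C) (n : ℕ) : homogeneousComponent n f ∈ vanishingIdeal k C := by
  intro v hv
  -- `q` is `f (c • v)` as a polynomial in `c`; it vanishes on the infinite field `k`, so all its
  -- coefficients are zero.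
  let q : Polynomial k := ∑ i ∈ Finset.range (f.totalDegree + 1),
    Polynomial.monomial i (eval v (homogeneousComponent i f))
  have hq : q = 0 := by
    refine Polynomial.funext fun c => ?_
    have := hf (c • v) (hC c v hv)
    rw [aeval_eq_eval, ← sum_homogeneousComponent f, map_sum] at this
    simp only [q, Polynomial.eval_finsetSum, Polynomial.eval_monomial, Polynomial.eval_zero]
    rw [← this]
    refine Finset.sum_congr rfl fun i _ => ?_
    rw [(homogeneousComponent_isHomogeneous i f).eval_smul, mul_comm]
  rw [aeval_eq_eval]
  rcases lt_or_ge f.totalDegree n with h | h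
  · rw [homogeneousComponent_eq_zero _ _ h, map_zero]
  · have := congrArg (fun q => q.coeff n) hq
    simpa [q, Polynomial.finsetSum_coeff, Polynomial.coeff_monomial, Nat.lt_succ_iff, h] using this

/-- The substitution `x ↦ x + t w`. -/
noncomputable def translate {σ k : Type*} [Field k] (w : σ → k) :
    MvPolynomial σ k →ₐ[k] Polynomial (MvPolynomial σ k) :=
  aeval fun j => Polynomial.C (X j) + Polynomial.C (C (w j)) * Polynomial.X

theorem eval_map_eval_translate {σ k : Type*} [Field k] (w v : σ → k) (c : k)
    (f : MvPolynomial σ k) :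
    ((translate w f).map (eval v)).eval c = eval (v + c • w) f := by
  have : ((Polynomial.evalRingHom c).comp (Polynomial.mapRingHom (eval v))).comp
      (translate w).toRingHom = eval (v + c • w) := by
    refine ringHom_ext (fun r => ?_) fun j => ?_
    · simp [translate]
    · simp [translate, mul_comm c]
  exact congrArg (fun φ => φ f) this

/-- Since `k` is infinite, `f` vanishes on all `v + c • w` exactly when every coefficient of `f (x +
t w)` in `t` vanishes on `C`. The quotient therefore embeds in a polynomial ring in one variable
over the ring of `C`. -/
theorem ringKrullDim_quotient_vanishingIdeal_add_smul_le {σ k : Type*} [Finite σ] [Field k]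
    [Infinite k] (C : Set (σ → k)) (w : σ → k) :
    ringKrullDim (MvPolynomial σ k ⧸ vanishingIdeal k {u | ∃ v ∈ C, ∃ c : k, u = v + c • w}) ≤
      ringKrullDim (MvPolynomial σ k ⧸ vanishingIdeal k C) + 1 := by
  set I := vanishingIdeal k C
  let φ : MvPolynomial σ k →ₐ[k] Polynomial (MvPolynomial σ k ⧸ I) :=
    (Polynomial.mapAlgHom (Ideal.Quotient.mkₐ k I)).comp (translate w)
  have hker : vanishingIdeal k {u | ∃ v ∈ C, ∃ c : k, u = v + c • w} = RingHom.ker φ := by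
    ext f
    have hφ : f ∈ RingHom.ker φ ↔ ∀ n, ∀ v ∈ C, eval v ((translate w f).coeff n) = 0 := by
      rw [RingHom.mem_ker, Polynomial.ext_iff]
      refine forall_congr' fun n => ?_
      simp [φ, Ideal.Quotient.eq_zero_iff_mem, I, aeval_eq_eval]
    rw [hφ]
    constructor
    · intro hf n v hv
      have : (translate w f).map (eval v) = 0 := by
        refine Polynomial.funext fun c => ?_
        rw [eval_map_eval_translate, Polynomial.eval_zero, ← aeval_eq_eval]
        exact hf _ ⟨v, hv, c, rfl⟩
      simpa using congrArg (fun q => q.coeff n) this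
    · rintro hf _ ⟨v, hv, c, rfl⟩
      have : (translate w f).map (eval v) = 0 := by
        ext n
        simpa using hf n v hv
      rw [aeval_eq_eval, ← eval_map_eval_translate, this, Polynomial.eval_zero]
  rw [hker, ← Polynomial.ringKrullDim_of_isNoetherianRing]
  have : Algebra.FiniteType k (Polynomial (MvPolynomial σ k ⧸ I)) :=
    Algebra.FiniteType.trans (S := MvPolynomial σ k ⧸ I) inferInstance inferInstance
  exact ringKrullDim_le_of_injective_algHom (Ideal.kerLiftAlg φ) (Ideal.kerLiftAlg_injective φ)

end MvPolynomial

theorem MvPolynomial.isMaximal_idealOfVars (σ k : Type*) [Field k] :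
    (idealOfVars σ k).IsMaximal := by
  have h : idealOfVars σ k = RingHom.ker (constantCoeff (σ := σ) (R := k)) := by
    ext f
    rw [← pow_one (idealOfVars σ k), mem_pow_idealOfVars_iff', RingHom.mem_ker,
      constantCoeff_eq]
    exact ⟨fun h => h 0 (by simp), fun h x hx => by
      rwa [(Finsupp.degree_eq_zero_iff x).1 (Nat.lt_one_iff.1 hx)]⟩
  rw [h]
  exact RingHom.ker_isMaximal_of_surjective _ fun c => ⟨C c, constantCoeff_C σ c⟩

/-! ### Linear projections and generic linear sections of cones -/

namespace ProjGeom

variable {k V : Type*} [Field k] [AddCommGroup V] [Module k V]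

theorem mem_annihilator_iff {m : ℕ} {l : Fin m → ℙ k (Module.Dual k V)} {v : V} :
    v ∈ annihilator l ↔ ∀ i, (l i).rep v = 0 := by
  rw [annihilator, Submodule.mem_dualCoannihilator]
  refine ⟨fun h i => h _ (le_iSup (fun i => (l i).submodule) i ?_), fun h φ hφ => ?_⟩
  · rw [Projectivization.submodule_eq]
    exact Submodule.mem_span_singleton_self _
  · have : (⨆ i, (l i).submodule) ≤ LinearMap.ker (Module.Dual.eval k V v) := by
      refine iSup_le fun i => ?_
      rw [Projectivization.submodule_eq, Submodule.span_singleton_le_iff_mem]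
      exact h i
    exact this hφ

theorem rep_mem_affineCone {X : Set (ℙ k V)} {q : ℙ k V} (hq : q ∈ X) :
    q.rep ∈ affineCone X :=
  Or.inr ⟨q.rep_nonzero, by rwa [q.mk_rep]⟩

theorem smul_mem_affineCone {X : Set (ℙ k V)} {v : V} (hv : v ∈ affineCone X) (c : k) :
    c • v ∈ affineCone X := by
  by_cases hcv : c • v = 0
  · exact Or.inl hcv
  · rcases hv with rfl | ⟨h, hX⟩
    · simp at hcv
    · refine Or.inr ⟨hcv, ?_⟩
      convert hX using 1
      rw [Projectivization.mk_eq_mk_iff']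
      exact ⟨c, rfl⟩

/-- If the cone over `X` with vertex `p` meets the center of projection only in the origin, then
the projection is defined on `X` and separates `p` from the other points of `X`. -/
theorem exists_subset_projectionDomain_preimage_eq_singleton {X : Set (ℙ k V)} {p : ℙ k V}
    (hp : p ∈ X) {W : Submodule k V}
    (hW : ∀ v ∈ affineCone X, ∀ c : k, v + c • p.rep ∈ W → v + c • p.rep = 0) :
    ∃ hdef : X ⊆ projectionDomain W,
      (fun q : X => linearProjection W ⟨q.1, hdef q.2⟩) ⁻¹'
        {linearProjection W ⟨p, hdef hp⟩} = {(⟨p, hp⟩ : X)} := by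
  refine ⟨fun q hq hqW => q.rep_nonzero ?_, ?_⟩
  · rw [Projectivization.submodule_eq, Submodule.span_singleton_le_iff_mem] at hqW
    -- The case `c = 0` says that the cone over `X` itself meets `W` only in the origin.
    simpa using hW q.rep (rep_mem_affineCone hq) 0 (by simpa using hqW)
  · ext ⟨q, hq⟩
    simp only [Set.mem_preimage, Set.mem_singleton_iff]
    refine ⟨fun h => Subtype.ext ?_, fun h => by cases h; rfl⟩
    obtain ⟨c, hc⟩ := (Projectivization.mk_eq_mk_iff' k _ _ _ _).1 h
    have hqp : q.rep + (-c) • p.rep ∈ W := by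
      rw [← Submodule.Quotient.mk_eq_zero, ← Submodule.mkQ_apply, map_add, map_smul, ← hc]
      simp
    have h0 := hW q.rep (rep_mem_affineCone hq) (-c) hqp
    change q = p
    rw [← q.mk_rep, ← p.mk_rep, Projectivization.mk_eq_mk_iff']
    exact ⟨c, by rw [← sub_eq_zero, ← neg_eq_zero, ← h0]; simp [sub_eq_add_neg, add_comm]⟩

variable [FiniteDimensional k V]

/-- Generic linear sections of the cone `C` of dimension at most `m` by `m` members of an
irreducible nondegenerate variety of linear forms meet `C` only in the origin. -/
theorem exists_isMultihomogeneous_forall_mem_eq_zero [Infinite k] {C : Set V}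
    (hC : ∀ c : k, ∀ v ∈ C, c • v ∈ C) {m : ℕ}
    (hdim : ringKrullDim (MvPolynomial (Fin (Module.finrank k V)) k ⧸
      MvPolynomial.vanishingIdeal k (coords (k := k) '' C)) ≤ m)
    {L : Set (ℙ k (Module.Dual k V))} (hLirr : IsIrreducibleVariety L)
    (hLnd : IsLinearlyNondegenerate L) :
    ∃ (F : MvPolynomial (Fin m × Fin (Module.finrank k (Module.Dual k V))) k) (d : Fin m → ℕ),
      IsMultihomogeneous F d ∧
      (∃ l : Fin m → ℙ k (Module.Dual k V), (∀ i, l i ∈ L) ∧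
        MvPolynomial.eval (fun x => coords (k := k) (l x.1).rep x.2) F ≠ 0) ∧
      ∀ l : Fin m → Module.Dual k V,
        MvPolynomial.eval (fun x => coords (k := k) (l x.1) x.2) F ≠ 0 →
        ∀ v ∈ C, (∀ i, l i v = 0) → v = 0 := by
  classical
  set σ := Fin (Module.finrank k V)
  set I := MvPolynomial.vanishingIdeal k (coords (k := k) '' C)
  have hI : ∀ f ∈ I, ∀ n, MvPolynomial.homogeneousComponent n f ∈ I := fun f hf n =>
    MvPolynomial.homogeneousComponent_mem_vanishingIdeal (by
      rintro c _ ⟨v, hv, rfl⟩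
      exact ⟨c • v, hC c v hv, by ext j; simp [coords]⟩) hf n
  have hM := MvPolynomial.isMaximal_idealOfVars σ k
  obtain ⟨t, htL, ht⟩ := exists_ringKrullDim_quotient_sup_span_range_le_zero hM
    (T := (fun q : ℙ k (Module.Dual k V) => linearPolynomial q.rep) '' L) (fun F hF hMF => by
      obtain ⟨q, hqL, hq⟩ := exists_mem_forall_rep_notMem hLirr hLnd
        (hF.image fun P => (P.restrictScalars k).comap linearPolynomial) (by
          rintro _ ⟨P, hP, rfl⟩ htop
          -- If all linear forms lay in `P`, so would the coordinates, which generate the irrelevant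
          -- ideal.
          refine hMF P hP (Ideal.span_le.2 ?_)
          rintro _ ⟨j, rfl⟩
          have : (Module.finBasis k V).coord j ∈ (P.restrictScalars k).comap linearPolynomial :=
            (SetLike.ext_iff.1 htop _).2 Submodule.mem_top
          rwa [Submodule.mem_comap, linearPolynomial_coord] at this)
      exact ⟨_, ⟨q, hqL, rfl⟩, fun P hP hqP => hq _ ⟨P, hP, rfl⟩ hqP⟩) m I hdim
  choose l₀ hl₀L hl₀ using htL
  obtain ⟨d, hd⟩ := MvPolynomial.exists_forall_isHomogeneous_sub_sum_mem hI
    (fun i => hl₀ i ▸ isHomogeneous_linearPolynomial _) ht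
  -- `E` is the piece of degree `d + 1` of the coordinate ring of `C`, and `B g` multiplies a linear
  -- form by `g` of degree `d`.
  let E : Submodule k (MvPolynomial σ k ⧸ I) :=
    (MvPolynomial.homogeneousSubmodule σ k (d + 1)).map (Ideal.Quotient.mkₐ k I).toLinearMap
  have : FiniteDimensional k E :=
    Module.Finite.iff_fg.2 ((MvPolynomial.homogeneousSubmodule_fg σ k (d + 1)).map _)
  let B (g : MvPolynomial.homogeneousSubmodule σ k d) : Module.Dual k V →ₗ[k] E :=
    LinearMap.codRestrict E ((Ideal.Quotient.mkₐ k I).toLinearMap ∘ₗ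
      LinearMap.mulRight k g.1 ∘ₗ linearPolynomial) fun φ =>
        ⟨linearPolynomial φ * g.1, by
          rw [add_comm]; exact (isHomogeneous_linearPolynomial φ).mul g.2, rfl⟩
  have hB (g) (φ) : (B g φ : MvPolynomial σ k ⧸ I) =
      Ideal.Quotient.mk I (linearPolynomial φ * g.1) := rfl
  obtain ⟨F, e, hF, hF0, hFl⟩ := exists_isMultihomogeneous_of_span_eq_top B
    (fun i => (l₀ i).rep) (by
      rw [eq_top_iff]
      rintro ⟨_, f, hf, rfl⟩ -
      obtain ⟨g, hg, hfg⟩ := hd f hf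
      have : (⟨Ideal.Quotient.mk I f, f, hf, rfl⟩ : E) = ∑ i, B ⟨g i, hg i⟩ (l₀ i).rep := by
        apply Subtype.ext
        rw [AddSubmonoidClass.coe_finsetSum]
        simp only [hB, ← map_sum]
        refine Ideal.Quotient.eq.2 ?_
        simpa only [hl₀] using hfg
      refine (congrArg (· ∈ Submodule.span k _) this).mpr ?_
      exact Submodule.sum_mem _ fun i _ => Submodule.subset_span ⟨(i, ⟨g i, hg i⟩), rfl⟩)
  refine ⟨F, e, hF, ⟨l₀, hl₀L, hF0⟩, fun l hl v hv hlv => ?_⟩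
  have hspan := hFl l hl
  have hevI : ∀ f ∈ I, MvPolynomial.eval (coords (k := k) v) f = 0 := fun f hf =>
    hf _ ⟨v, hv, rfl⟩
  let ev : (MvPolynomial σ k ⧸ I) →ₗ[k] k :=
    (Ideal.Quotient.liftₐ I (MvPolynomial.aeval (coords (k := k) v)) hevI).toLinearMap
  -- Evaluation at a common zero `v ∈ C` kills the products `l i * g`, which span `E`; so it kills
  -- each `X j ^ (d + 1)`, and `v = 0`.
  have hev0 : ev ∘ₗ E.subtype = 0 := by
    refine LinearMap.ext_on_range hspan fun x => ?_
    change MvPolynomial.eval (coords (k := k) v) (linearPolynomial (l x.1) * x.2.1) = 0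
    rw [map_mul, eval_coords_linearPolynomial, hlv, zero_mul]
  have hcoord (j : σ) : coords (k := k) v j = 0 := by
    have hX : (MvPolynomial.X j ^ (d + 1) : MvPolynomial σ k).IsHomogeneous (d + 1) :=
      MvPolynomial.isHomogeneous_X_pow j (d + 1)
    have := LinearMap.congr_fun hev0 ⟨_, MvPolynomial.X j ^ (d + 1), hX, rfl⟩
    change MvPolynomial.eval (coords (k := k) v) (MvPolynomial.X j ^ (d + 1)) = 0 at this
    simpa using this
  exact (Module.finBasis k V).repr.map_eq_zero_iff.1 (Finsupp.ext hcoord)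

end ProjGeom

theorem mainTheorem3 {k : Type*} [Field k] [Infinite k]
    {V : Type*} [AddCommGroup V] [Module k V] [FiniteDimensional k V]
    (X : Set (ℙ k V)) (hX : ProjGeom.IsZariskiClosed X)
    (n : ℕ) (hn : ProjGeom.HasDimension X n)
    (L : Set (ℙ k (Module.Dual k V))) (hL : ProjGeom.IsZariskiClosed L)
    (hLirr : ProjGeom.IsIrreducibleVariety L)
    (hLnd : ProjGeom.IsLinearlyNondegenerate L)
    (p : ℙ k V) (hp : p ∈ X) :
    ProjGeom.GenericTuple L (n + 2) fun ℓ =>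
      ∃ hdef : X ⊆ ProjGeom.projectionDomain (ProjGeom.annihilator ℓ),
        (fun q : X => ProjGeom.linearProjection (ProjGeom.annihilator ℓ) ⟨q.1, hdef q.2⟩) ⁻¹'
            {ProjGeom.linearProjection (ProjGeom.annihilator ℓ) ⟨p, hdef hp⟩} =
          {(⟨p, hp⟩ : X)} := by
  let C : Set V := {u | ∃ v ∈ ProjGeom.affineCone X, ∃ c : k, u = v + c • p.rep}
  have hC : ∀ a : k, ∀ u ∈ C, a • u ∈ C := by
    rintro a _ ⟨v, hv, c, rfl⟩
    exact ⟨a • v, ProjGeom.smul_mem_affineCone hv a, a * c, by rw [smul_add, mul_smul]⟩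
  have hCimage : ProjGeom.coords (k := k) '' C =
      {u | ∃ v ∈ ProjGeom.coords (k := k) '' ProjGeom.affineCone X, ∃ c : k,
        u = v + c • ProjGeom.coords (k := k) p.rep} := by
    have hadd (v : V) (c : k) : ProjGeom.coords (k := k) (v + c • p.rep) =
        ProjGeom.coords (k := k) v + c • ProjGeom.coords (k := k) p.rep := by
      ext j
      simp [ProjGeom.coords]
    ext u
    constructor
    · rintro ⟨_, ⟨v, hv, c, rfl⟩, rfl⟩
      exact ⟨_, ⟨v, hv, rfl⟩, c, hadd v c⟩
    · rintro ⟨_, ⟨v, hv, rfl⟩, c, rfl⟩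
      exact ⟨_, ⟨v, hv, c, rfl⟩, hadd v c⟩
  obtain ⟨F, d, hF, ⟨l₀, hl₀L, hl₀⟩, hFl⟩ :=
    ProjGeom.exists_isMultihomogeneous_forall_mem_eq_zero hC (m := n + 2) (by
      rw [hCimage]
      refine (MvPolynomial.ringKrullDim_quotient_vanishingIdeal_add_smul_le _ _).trans ?_
      -- The ring of `X` has dimension `n + 1`, and the join with `p` adds at most one: this is why
      -- `n + 2` forms are taken.
      rw [show ringKrullDim _ = _ from hn]
      rfl) hLirr hLnd
  refine ⟨{l | MvPolynomial.eval (fun x => ProjGeom.coords (k := k) (l x.1).rep x.2) F = 0},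
    ⟨{F}, by simpa using ⟨d, hF⟩, by simp⟩, ⟨l₀, hl₀L, hl₀⟩, fun l _ hl => ?_⟩
  refine ProjGeom.exists_subset_projectionDomain_preimage_eq_singleton hp fun v hv c hvc => ?_
  exact hFl (fun i => (l i).rep) hl _ ⟨v, hv, c, rfl⟩ (ProjGeom.mem_annihilator_iff.1 hvc)
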